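/- All residue field extensions below are the canonical ones, and $\kappa(x)$ denotes the residue field of a scheme at a point $x$. For a morphism of schemes $f : X \to S$, let $\mathrm{QRel}(f) \subset S$ (resp. $\mathrm{Rel}(f) \subset S$) be the set of points $f(x)$, where $x \in X$ is such that the extension $\kappa(f(x)) \subset \kappa(x)$ is purely inseparable (resp. trivial, i.e. an isomorphism). The morphism $f$ is called quasi-étale if it factors as $X \xrightarrow{\rho} X_0 \xrightarrow{\pi} S$ with $\pi$ étale and $\rho$ integral, surjective and radicial (universally injective). A scheme $S$ is called a Poonen scheme if for every nonempty open subset $U \subset S$ and every dominant morphism $f : X \to U$ of finite presentation (locally of finite presentation, quasi-compact and quasi-separated), one has $\mathrm{QRel}(f) \neq \emptyset$. **Proposition 4.1.1.** Let $S$ be a scheme. The following conditions are equivalent: (i) $S$ is a Poonen scheme; (ii) for every nonempty affine open $U$ of $S$ and every finite, surjective, quasi-étale morphism $f : X \to U$, one has $\mathrm{QRel}(f) \neq \emptyset$; (iii) for every nonempty affine open $U$ of $S$ and every finite, étale, surjective morphism $f : X \to U$, one has $\mathrm{QRel}(f) \neq \emptyset$; (iv) for every nonempty affine open $U$ of $S$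 and every finite, étale, surjective morphism $f : X \to U$, one has $\mathrm{Rel}(f) \neq \emptyset$. -/

import Mathlib

open CategoryTheory AlgebraicGeometry

universe u

namespace PoonenScheme

/-- Points of `X` whose residue field is purely inseparable over that of their image. -/
def QRelTilde {X S : Scheme.{u}} (f : X ⟶ S) : Set X :=
  {x | (f.residueFieldMap x).hom.IsPurelyInseparable}

/-- Points of `X` with the same residue field as their image. -/
def RelTilde {X S : Scheme.{u}} (f : X ⟶ S) : Set X :=
  {x | Function.Bijective (f.residueFieldMap x).hom}

/-- The quasi-liftable points of `S`. -/
def QRel {X S : Scheme.{u}} (f : X ⟶ S) : Set S := f '' QRelTilde f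

/-- The liftable points of `S`. -/
def Rel {X S : Scheme.{u}} (f : X ⟶ S) : Set S := f '' RelTilde f

/-- A morphism is quasi-étale if it is the composite of an integral surjective radicial
(that is, universally injective) morphism followed by an étale morphism. -/
def IsQuasiEtale {X S : Scheme.{u}} (f : X ⟶ S) : Prop :=
  ∃ (X₀ : Scheme.{u}) (ρ : X ⟶ X₀) (p : X₀ ⟶ S),
    IsIntegralHom ρ ∧ Surjective ρ ∧ UniversallyInjective ρ ∧ Etale p ∧ ρ ≫ p = f

/-- Morphisms of finite presentation: locally of finite presentation, quasi-compact and
quasi-separated. -/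
def IsOfFinitePresentation {X S : Scheme.{u}} (f : X ⟶ S) : Prop :=
  LocallyOfFinitePresentation f ∧ QuasiCompact f ∧ QuasiSeparated f

/-- `S` is a Poonen scheme if for every nonempty open `U` of `S`, every dominant `U`-scheme
of finite presentation has a quasi-liftable point. -/
def IsPoonen (S : Scheme.{u}) : Prop :=
  ∀ (U : S.Opens), (U : Set S).Nonempty → ∀ (X : Scheme.{u}) (f : X ⟶ (U : Scheme.{u})),
    IsOfFinitePresentation f → IsDominant f → (QRel f).Nonempty

end PoonenScheme

/-! The main point is that (iii) implies (i). After shrinking, a dominant finitely presented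
morphism becomes `Spec B → Spec A` and hits a minimal prime `p`, so `B` has a point in a finite
extension `K` of `κ(p)`. Up to `q`-power roots, `K` is generated by one separable element `θ`.
Because `p` is minimal, finitely many identities over `κ(p)` spread out, up to nilpotents, to a
localization `A'` of `A`. A lift `g` of the minimal polynomial of `θ` thus gives a finite étale
cover `C = A'[X]/g`, each of whose field-valued points yields a point of `B` after a purely
inseparable extension (`exists_finite_etale_cover`). A quasi-liftable point of `Spec C → Spec A'`
therefore produces one for the original morphism.

For (i) ⇒ (ii), the integral radicial surjection does not affect quasi-liftability, and the étale
part is handled by an affine étale cover. Finally, (iii) and (iv) agree because residue extensions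
of étale morphisms are separable. -/

namespace PoonenScheme

/-! ### Frobenius twists of polynomial equations -/

section FrobEval

open Polynomial

/-- The value at `h` of the polynomial obtained from `F` by raising its coefficients to the
power `q`. -/
noncomputable def frobEval {A R σ : Type*} [CommRing A] [CommRing R] [Algebra A R] (q : ℕ)
    (F : MvPolynomial σ A) (h : σ → R) : R :=
  ∑ m ∈ F.support, algebraMap A R (F.coeff m) ^ q * m.prod fun j e ↦ h j ^ e

variable {A R R' σ : Type*} [CommRing A] [CommRing R] [Algebra A R] [CommRing R'] [Algebra A R']

lemma map_frobEval (φ : R →ₐ[A] R') (q : ℕ) (F : MvPolynomial σ A) (h : σ → R) :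
    φ (frobEval q F h) = frobEval q F (fun j ↦ φ (h j)) := by
  simp [frobEval, Finsupp.prod, map_sum, map_prod]

/-- When `x ↦ x ^ q` is additive it is a ring endomorphism. Assuming additivity alone treats
characteristic zero, with `q = 1`, uniformly. -/
lemma frobEval_pow {q : ℕ} (hq : q ≠ 0) (hadd : ∀ x y : R, (x + y) ^ q = x ^ q + y ^ q)
    (F : MvPolynomial σ A) (y : σ → R) :
    frobEval q F (fun j ↦ y j ^ q) = (MvPolynomial.aeval y F) ^ q := by
  let fr : R →+* R :=
    { toFun := fun x ↦ x ^ q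
      map_one' := one_pow q
      map_mul' := fun x y ↦ mul_pow x y q
      map_zero' := zero_pow hq
      map_add' := hadd }
  change _ = fr _
  rw [MvPolynomial.aeval_def, MvPolynomial.eval₂_eq, map_sum]
  refine Finset.sum_congr rfl fun m _ ↦ ?_
  simp only [fr, Finsupp.prod, RingHom.coe_mk, MonoidHom.coe_mk, OneHom.coe_mk, mul_pow,
    ← pow_mul, ← Finset.prod_pow]
  congr 1
  exact Finset.prod_congr rfl fun j _ ↦ by rw [mul_comm]

end FrobEval

/-! ### Extracting `q`-power roots -/

section Perfect

/-- A field has a purely inseparable extension containing all `q`-th roots. -/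
lemma exists_isPurelyInseparable_pow {F : Type u} [Field F] {p n : ℕ}
    (hp : p = 1 ∨ p.Prime ∧ (p : F) = 0) :
    ∃ (F' : Type u) (_ : Field F') (_ : Algebra F F'), IsPurelyInseparable F F' ∧
      (∀ x y : F', (x + y) ^ p ^ n = x ^ p ^ n + y ^ p ^ n) ∧
      ∀ z : F, ∃ y : F', y ^ p ^ n = algebraMap F F' z := by
  obtain rfl | ⟨hp, hF⟩ := hp
  · exact ⟨F, inferInstance, inferInstance, inferInstance, by simp, by simp⟩
  · have : CharP F p := (CharP.charP_iff_prime_eq_zero hp).mpr hF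
    have : Fact p.Prime := ⟨hp⟩
    have : ExpChar F p := .prime hp
    let F' := perfectClosure F (AlgebraicClosure F)
    have : ExpChar F' p := expChar_of_injective_algebraMap (algebraMap F F').injective p
    refine ⟨F', inferInstance, inferInstance, inferInstance,
      fun x y ↦ add_pow_expChar_pow x y p n, fun z ↦ ?_⟩
    obtain ⟨y, hy⟩ := IsAlgClosed.exists_pow_nat_eq (algebraMap F (AlgebraicClosure F) z)
      (pow_pos hp.pos n)
    refine ⟨⟨y, (mem_perfectClosure_iff_pow_mem p).mpr ⟨n, z, hy.symm⟩⟩, Subtype.ext ?_⟩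
    exact hy

end Perfect

/-! ### Spreading out from a minimal prime -/

section Spread

open Polynomial

variable {A κ : Type*} [CommRing A] [Field κ]

/-- Every element of the kernel of `ψ : A → κ` becomes nilpotent after inverting an element
outside the kernel. -/
def NilpotentNearKer (ψ : A →+* κ) : Prop :=
  ∀ a, ψ a = 0 → ∃ b, ψ b ≠ 0 ∧ IsNilpotent (b * a)

/-- Otherwise the multiplicative set generated by `a` and the complement of the kernel misses `0`,
and a prime avoiding it lies strictly inside the minimal prime. -/
lemma NilpotentNearKer.of_mem_minimalPrimes {ψ : A →+* κ}
    (h : RingHom.ker ψ ∈ minimalPrimes A) : NilpotentNearKer ψ := by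
  intro a ha
  have hp : (RingHom.ker ψ).IsPrime := RingHom.ker_isPrime ψ
  by_contra! H
  have hdisj : Disjoint ((⊥ : Ideal A) : Set A)
      ((RingHom.ker ψ).primeCompl ⊔ Submonoid.powers a : Submonoid A) := by
    refine Set.disjoint_left.mpr fun x hx0 hx ↦ ?_
    obtain ⟨b, hb, _, ⟨n, rfl⟩, rfl⟩ := Submonoid.mem_sup.mp hx
    refine H b hb ⟨n + 1, ?_⟩
    have hx0 : b * a ^ n = 0 := hx0
    linear_combination b ^ n * a * hx0
  obtain ⟨q, hq, -, hqS⟩ := Ideal.exists_le_prime_disjoint _ _ hdisj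
  have hqp : q ≤ RingHom.ker ψ := fun x hx ↦ by
    by_contra hxp
    exact Set.disjoint_left.mp hqS hx (Submonoid.mem_sup_left (S := (RingHom.ker ψ).primeCompl) hxp)
  exact Set.disjoint_left.mp hqS (h.2 ⟨hq, bot_le⟩ hqp ha)
    (Submonoid.mem_sup_right (Submonoid.mem_powers a))

lemma isNilpotent_of_mul_isUnit {R : Type*} [CommRing R] {x u : R} (hu : IsUnit u)
    (h : IsNilpotent (x * u)) : IsNilpotent x := by
  obtain ⟨n, hn⟩ := h
  exact ⟨n, (hu.pow n).mul_left_eq_zero.mp (by rwa [← mul_pow])⟩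

lemma NilpotentNearKer.finset {ψ : A →+* κ} (h : NilpotentNearKer ψ) (s : Finset A)
    (hs : ∀ a ∈ s, ψ a = 0) : ∃ b, ψ b ≠ 0 ∧ ∀ a ∈ s, IsNilpotent (b * a) := by
  classical
  choose! b hb hn using h
  refine ⟨∏ a ∈ s, b a, ?_, fun a ha ↦ ?_⟩
  · rw [map_prod]
    exact Finset.prod_ne_zero_iff.mpr fun a ha ↦ hb a (hs a ha)
  · rw [← Finset.prod_erase_mul _ _ ha, mul_assoc]
    exact (Commute.all _ _).isNilpotent_mul_left (hn a (hs a ha))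

lemma NilpotentNearKer.localizationAway {ψ : A →+* κ} (h : NilpotentNearKer ψ) {b : A}
    {A' : Type*} [CommRing A'] [Algebra A A'] [IsLocalization.Away b A'] {ψ' : A' →+* κ}
    (hψ : ψ'.comp (algebraMap A A') = ψ) : NilpotentNearKer ψ' := by
  intro x hx
  obtain ⟨n, a, ha⟩ := IsLocalization.Away.surj b x
  have hψ' (a) : ψ' (algebraMap A A' a) = ψ a := by rw [← hψ]; rfl
  obtain ⟨c, hc, hn⟩ := h a (by rw [← hψ', ← ha, map_mul, hx, zero_mul])
  refine ⟨algebraMap A A' c, by rwa [hψ'], ?_⟩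
  have hu : IsUnit (algebraMap A A' b ^ n) := (IsLocalization.Away.algebraMap_isUnit b).pow n
  have := hn.map (algebraMap A A')
  rw [map_mul, ← ha, ← mul_assoc] at this
  exact isNilpotent_of_mul_isUnit hu this

/-- Finitely many elements of a residue field lift to a localization. -/
lemma exists_away_forall_mem_range (p : Ideal A) [p.IsPrime] (s : Finset p.ResidueField) :
    ∃ b ∉ p, ∀ (A' : Type*) [CommRing A'] [Algebra A A'] [IsLocalization.Away b A']
      (ψ' : A' →+* p.ResidueField), ψ'.comp (algebraMap A A') = algebraMap A p.ResidueField →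
      ∀ c ∈ s, c ∈ ψ'.range := by
  obtain ⟨⟨d, hd⟩, h⟩ := IsLocalization.exist_integer_multiples_of_finset
    (nonZeroDivisors (A ⧸ p)) s
  obtain ⟨b, rfl⟩ := Ideal.Quotient.mk_surjective d
  have hb : b ∉ p := fun hb ↦ nonZeroDivisors.ne_zero hd (Ideal.Quotient.eq_zero_iff_mem.mpr hb)
  refine ⟨b, hb, fun A' _ _ _ ψ' hψ c hc ↦ ?_⟩
  obtain ⟨a, ha⟩ := h c hc
  obtain ⟨a, rfl⟩ := Ideal.Quotient.mk_surjective a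
  have hψ' (a) : ψ' (algebraMap A A' a) = algebraMap A _ a := by rw [← hψ]; rfl
  have hb0 : algebraMap A p.ResidueField b ≠ 0 := by
    rwa [Ne, Ideal.algebraMap_residueField_eq_zero]
  refine ⟨algebraMap A A' a * IsLocalization.Away.invSelf b, ?_⟩
  have h1 : ψ' (IsLocalization.Away.invSelf b) * algebraMap A _ b = 1 := by
    rw [← hψ', ← map_mul, mul_comm, IsLocalization.Away.mul_invSelf, map_one]
  rw [map_mul, hψ', ← mul_left_inj' hb0, mul_assoc, h1, mul_one, mul_comm]
  simpa [Algebra.smul_def] using ha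

/-- Polynomials vanishing at `θ` become nilpotent modulo a lift `g` of the minimal polynomial of `θ`
after localizing. -/
lemma NilpotentNearKer.exists_dvd_pow {K : Type*} [Field K] [Algebra κ K] {ψ : A →+* κ}
    (h : NilpotentNearKer ψ) {θ : K} {g : A[X]} (hg : g.Monic) (hgθ : g.map ψ = minpoly κ θ)
    (s : Finset A[X]) (hs : ∀ E ∈ s, aeval θ (E.map ψ) = 0) :
    ∃ b, ψ b ≠ 0 ∧ ∀ (A' : Type*) [CommRing A'] [Algebra A A'] [IsLocalization.Away b A'],
      ∀ E ∈ s, ∃ n, g.map (algebraMap A A') ∣ E.map (algebraMap A A') ^ n := by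
  classical
  -- The remainders modulo `g` reduce to `0` under `ψ`, so their finitely many coefficients become
  -- nilpotent together.
  obtain ⟨b, hb, hn⟩ := h.finset (s.biUnion fun E ↦ (E %ₘ g).coeffs) (by
    intro a ha
    obtain ⟨E, hE, ha⟩ := Finset.mem_biUnion.mp ha
    obtain ⟨n, -, rfl⟩ := mem_coeffs_iff.mp ha
    have : (E %ₘ g).map ψ = 0 := by
      rw [map_modByMonic _ hg, hgθ]
      exact (modByMonic_eq_zero_iff_dvd (hgθ ▸ hg.map ψ)).mpr (minpoly.dvd _ _ (hs E hE))
    rw [← coeff_map, this, coeff_zero])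
  refine ⟨b, hb, fun A' _ _ _ E hE ↦ ?_⟩
  have hnil : IsNilpotent ((E %ₘ g).map (algebraMap A A')) := by
    refine Polynomial.isNilpotent_iff.mpr fun i ↦ ?_
    rw [coeff_map]
    by_cases h0 : (E %ₘ g).coeff i = 0
    · simp [h0]
    have := (hn _ (Finset.mem_biUnion.mpr ⟨E, hE, coeff_mem_coeffs h0⟩)).map
      (algebraMap A A')
    rw [map_mul] at this
    have hu : IsUnit (algebraMap A A' b) := IsLocalization.Away.algebraMap_isUnit b
    exact isNilpotent_of_mul_isUnit hu (by rwa [mul_comm])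
  obtain ⟨n, hn⟩ := hnil
  refine ⟨n, ?_⟩
  have e : E.map (algebraMap A A') = (E %ₘ g).map (algebraMap A A') +
      g.map (algebraMap A A') * (E /ₘ g).map (algebraMap A A') := by
    rw [← Polynomial.map_mul, ← Polynomial.map_add, modByMonic_add_div]
  have := sub_dvd_pow_sub_pow (E.map (algebraMap A A')) ((E %ₘ g).map (algebraMap A A')) n
  rw [hn, sub_zero] at this
  refine .trans ?_ this
  rw [e, add_sub_cancel_left]
  exact dvd_mul_right _ _

end Spread

/-! ### Finite étale algebras `R[X]/g` -/

section StandardEtale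

open Polynomial

variable {R : Type u} [CommRing R] (P : StandardEtalePair R)

lemma finite_of_g_eq_one (hg : P.g = 1) : Module.Finite R P.Ring := by
  have := P.monic_f.finite_adjoinRoot
  let φ : AdjoinRoot P.f →ₐ[R] P.Ring := AdjoinRoot.liftAlgHom P.f (Algebra.ofId R P.Ring) P.X
    P.hasMap_X.1
  let χ : P.Ring →ₐ[R] AdjoinRoot P.f := P.lift (AdjoinRoot.root P.f)
    ⟨by rw [AdjoinRoot.aeval_eq, AdjoinRoot.mk_self], by simp [hg]⟩
  have hχ : χ P.X = AdjoinRoot.root P.f := StandardEtalePair.lift_X ..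
  have hφ : φ (AdjoinRoot.root P.f) = P.X := AdjoinRoot.liftAlgHom_root ..
  have h : φ.comp χ = AlgHom.id R P.Ring :=
    StandardEtalePair.hom_ext ((congrArg φ hχ).trans hφ)
  exact Module.Finite.of_surjective φ.toLinearMap fun y ↦ ⟨χ y, DFunLike.congr_fun h y⟩

/-- A nonconstant monic polynomial has a root over the algebraic closure of each residue field, and
nothing is inverted when `P.g = 1`. -/
lemma comap_surjective_of_g_eq_one (hg : P.g = 1) (hd : P.f.natDegree ≠ 0) :
    Function.Surjective (PrimeSpectrum.comap (algebraMap R P.Ring)) := by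
  intro q
  let L := AlgebraicClosure q.asIdeal.ResidueField
  have : Nontrivial R := q.nontrivial
  obtain ⟨x, hx⟩ := IsAlgClosed.exists_root (P.f.map (algebraMap R L)) (by
    rw [P.monic_f.degree_map, degree_eq_natDegree P.monic_f.ne_zero]; exact_mod_cast hd)
  let φ : P.Ring →ₐ[R] L := P.lift x ⟨by rwa [IsRoot, eval_map_algebraMap] at hx, by simp [hg]⟩
  refine ⟨⟨RingHom.ker φ, RingHom.ker_isPrime _⟩, PrimeSpectrum.ext (Ideal.ext fun a ↦ ?_)⟩
  rw [PrimeSpectrum.comap_asIdeal, Ideal.mem_comap, RingHom.mem_ker, AlgHom.commutes,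
    IsScalarTower.algebraMap_apply R q.asIdeal.ResidueField L,
    map_eq_zero_iff _ (algebraMap q.asIdeal.ResidueField L).injective,
    Ideal.algebraMap_residueField_eq_zero]

/-- If the derivative of a monic polynomial `g` is a unit in `R[X]/g` up to nilpotents, then
`R[X]/g` is standard étale. -/
lemma exists_standardEtalePair {g : R[X]} (hg : g.Monic) {a : R[X]} {n : ℕ}
    (h : g ∣ (a * derivative g - 1) ^ n) : ∃ P : StandardEtalePair R, P.f = g ∧ P.g = 1 := by
  have hnil : IsNilpotent (AdjoinRoot.mk g (a * derivative g - 1)) :=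
    ⟨n, by rwa [← map_pow, AdjoinRoot.mk_eq_zero]⟩
  have hu : IsUnit (AdjoinRoot.mk g (a * derivative g)) := by
    simpa using hnil.isUnit_add_one
  obtain ⟨c, hc⟩ := hu.exists_right_inv
  obtain ⟨c, rfl⟩ := AdjoinRoot.mk_surjective c
  rw [← map_mul, ← map_one (AdjoinRoot.mk g), AdjoinRoot.mk_eq_mk] at hc
  obtain ⟨r, hr⟩ := hc
  exact ⟨⟨g, hg, 1, a * c, -r, 1, by linear_combination hr⟩, rfl, rfl⟩

end StandardEtale

/-! ### Construction of the étale cover -/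

section ExistsCover

open Polynomial

lemma eq_one_or_prime_and_cast_eq_zero (κ : Type*) [Field κ] (q : ℕ) [h : ExpChar κ q] :
    q = 1 ∨ q.Prime ∧ (q : κ) = 0 := by
  cases h with
  | zero => exact .inl rfl
  | prime h => exact .inr ⟨h, CharP.cast_eq_zero κ q⟩

/-- A finite extension is generated, up to `q`-th powers, by one separable element. -/
lemma exists_isSeparable_forall_aeval_eq_pow (κ K : Type*) [Field κ] [Field K] [Algebra κ K]
    [FiniteDimensional κ K] :
    ∃ (θ : K) (n : ℕ), IsSeparable κ θ ∧
      ∀ x : K, ∃ H : κ[X], aeval θ H = x ^ ringExpChar κ ^ n := by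
  let L := separableClosure κ K
  obtain ⟨θ, hθ⟩ := Field.exists_primitive_element κ L
  have : FiniteDimensional L K := .right κ L K
  have := IsPurelyInseparable.hasExponent_of_finiteDimensional (K := L) (L := K)
  have : ExpChar L (ringExpChar κ) :=
    expChar_of_injective_algebraMap (algebraMap κ L).injective _
  refine ⟨θ, IsPurelyInseparable.exponent L K, mem_separableClosure_iff.mp θ.2, fun x ↦ ?_⟩
  obtain ⟨y, hy⟩ := IsPurelyInseparable.exponent_def' L (ringExpChar κ) x
  have hy' : y ∈ Algebra.adjoin κ {θ} := by
    rw [(IntermediateField.adjoin_simple_eq_top_iff_of_isAlgebraic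
      (Algebra.IsAlgebraic.isAlgebraic θ)).mp hθ]
    trivial
  rw [Algebra.adjoin_singleton_eq_range_aeval] at hy'
  obtain ⟨H, rfl⟩ := hy'
  refine ⟨H, ?_⟩
  rw [← hy]
  exact aeval_algebraMap_apply K θ H

variable {A B : Type u} [CommRing A] [CommRing B] [Algebra A B]

/-- Nullstellensatz: a residue field at a maximal ideal of the nonzero fiber ring is finite over
`κ(p)`. -/
lemma exists_finite_field_of_mem_range [Algebra.FiniteType A B] (p : PrimeSpectrum A)
    (h : p ∈ Set.range (PrimeSpectrum.comap (algebraMap A B))) :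
    ∃ (K : Type u) (_ : Field K) (_ : Algebra p.asIdeal.ResidueField K) (β : B →+* K),
      Module.Finite p.asIdeal.ResidueField K ∧
      β.comp (algebraMap A B) = (algebraMap p.asIdeal.ResidueField K).comp (algebraMap A _) := by
  have : Nontrivial (TensorProduct A p.asIdeal.ResidueField B) :=
    (PrimeSpectrum.nontrivial_iff_mem_rangeComap p).mpr h
  let T := TensorProduct A p.asIdeal.ResidueField B
  obtain ⟨M, hM⟩ := Ideal.exists_maximal T
  let : Field (T ⧸ M) := Ideal.Quotient.field M
  have : Algebra.FiniteType p.asIdeal.ResidueField T := inferInstance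
  have : Algebra.FiniteType p.asIdeal.ResidueField (T ⧸ M) := inferInstance
  refine ⟨T ⧸ M, inferInstance, inferInstance,
    (Ideal.Quotient.mk M).comp Algebra.TensorProduct.includeRight.toRingHom,
    finite_of_finite_type_of_isJacobsonRing _ _, RingHom.ext fun a ↦ ?_⟩
  have := (Algebra.TensorProduct.includeRight : B →ₐ[A] T).commutes a
  simp only [RingHom.comp_apply]
  refine (congrArg (Ideal.Quotient.mk M) this).trans ?_
  rfl

/-- The twisted equations hold modulo `g` only up to nilpotents, hence exactly at field-valued
points. Taking `p ^ n`-th roots of the values of `h` then solves the original equations. -/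
lemma NilpotentNearKer.exists_standardEtalePair_of_frobEval {κ K σ A₀ : Type*} {A : Type u}
    [Field κ] [Field K] [Algebra κ K] [CommRing A] [CommRing A₀] [Algebra A₀ A] {ψ : A →+* κ} (hψ : NilpotentNearKer ψ)
    {θ : K} {g a : A[X]} (hg : g.Monic) (hgθ : g.map ψ = minpoly κ θ) (hd : g.natDegree ≠ 0)
    (ha : aeval θ ((a * derivative g - 1).map ψ) = 0)
    {p n : ℕ} (hp : p = 1 ∨ p.Prime ∧ (p : κ) = 0) (s : Finset (MvPolynomial σ A₀)) (h : σ → A[X])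
    (hs : ∀ G ∈ s, aeval θ ((frobEval (p ^ n) G h).map ψ) = 0) :
    ∃ b, ψ b ≠ 0 ∧ ∃ P : StandardEtalePair (Localization.Away b), P.g = 1 ∧ P.f.natDegree ≠ 0 ∧
      ∀ (F : Type u) [Field F] (χ : P.Ring →+* F),
        ∃ (F' : Type u) (_ : Field F') (_ : Algebra F F') (y : σ → F'), IsPurelyInseparable F F' ∧
          ∀ G ∈ s, MvPolynomial.eval₂ ((algebraMap F F').comp (χ.comp
            ((algebraMap (Localization.Away b) P.Ring).comp
              ((algebraMap A (Localization.Away b)).comp (algebraMap A₀ A))))) y G = 0 := by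
  classical
  -- Treating `p = 0` as one more equation to spread out forces the field `F` below to have
  -- characteristic `p`; for `p = 1` no condition is wanted.
  let E : A[X] := if p = 1 then 0 else C (p : A)
  obtain ⟨b, hb, H⟩ := hψ.exists_dvd_pow hg hgθ
    (insert (a * derivative g - 1) (insert E (s.image fun G ↦ frobEval (p ^ n) G h))) (by
      simp only [Finset.mem_insert, Finset.mem_image]
      rintro _ (rfl | rfl | ⟨G, hG, rfl⟩)
      · exact ha
      · dsimp only [E]
        split_ifs with h1
        · simp
        · have h0 := (hp.resolve_left h1).2
          rw [Polynomial.map_C, map_natCast, h0, C_0, map_zero]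
      · exact hs G hG)
  let A' := Localization.Away b
  replace H := H A'
  have : Nontrivial A' := RingHom.domain_nontrivial
    (IsLocalization.Away.lift b (g := ψ) hb.isUnit : A' →+* κ)
  obtain ⟨m, hm⟩ := H (a * derivative g - 1) (by simp)
  obtain ⟨P, hPf, hPg⟩ := PoonenScheme.exists_standardEtalePair (hg.map (algebraMap A A'))
    (a := a.map (algebraMap A A')) (n := m) (by simpa [derivative_map] using hm)
  refine ⟨b, hb, P, hPg, by rwa [hPf, hg.natDegree_map], fun F _ χ ↦ ?_⟩
  let ι : A →+* F := χ.comp ((algebraMap A' P.Ring).comp (algebraMap A A'))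
  have hE : ∀ D ∈ insert (a * derivative g - 1)
      (insert E (s.image fun G ↦ frobEval (p ^ n) G h)), D.eval₂ ι (χ P.X) = 0 := by
    intro D hD
    obtain ⟨m, r, hr⟩ := H D hD
    have h0 : eval₂ (χ.comp (algebraMap A' P.Ring)) (χ P.X) P.f = 0 := by
      rw [← hom_eval₂, ← aeval_def, P.hasMap_X.1, map_zero]
    rw [hPf] at h0
    have := congrArg (eval₂ (χ.comp (algebraMap A' P.Ring)) (χ P.X)) hr
    rw [eval₂_mul, h0, zero_mul, eval₂_pow, eval₂_map] at this
    exact eq_zero_of_pow_eq_zero this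
  have hpF : p = 1 ∨ p.Prime ∧ (p : F) = 0 := by
    by_cases h1 : p = 1
    · exact .inl h1
    · exact .inr ⟨(hp.resolve_left h1).1, by simpa [E, h1] using hE E (by simp)⟩
  obtain ⟨F', _, _, hF', hadd, hroot⟩ := exists_isPurelyInseparable_pow (n := n) hpF
  choose y hy using fun j ↦ hroot ((h j).eval₂ ι (χ P.X))
  refine ⟨F', inferInstance, inferInstance, y, hF', fun G hG ↦ ?_⟩
  let : Algebra A F' := ((algebraMap F F').comp ι).toAlgebra
  let : Algebra A₀ F' := ((algebraMap A F').comp (algebraMap A₀ A)).toAlgebra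
  have : IsScalarTower A₀ A F' := .of_algebraMap_eq' rfl
  let φ : A[X] →ₐ[A₀] F' := (aeval (algebraMap F F' (χ P.X))).restrictScalars A₀
  have hφ (E : A[X]) : φ E = algebraMap F F' (E.eval₂ ι (χ P.X)) := by
    rw [hom_eval₂]; rfl
  have hp0 : p ^ n ≠ 0 := pow_ne_zero _ (by rintro rfl; simp [Nat.not_prime_zero] at hp)
  change MvPolynomial.aeval y G = 0
  rw [← pow_eq_zero_iff hp0, ← frobEval_pow hp0 hadd]
  simp only [hy, ← hφ]
  rw [← map_frobEval, hφ, hE _ (Finset.mem_insert_of_mem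
    (Finset.mem_insert_of_mem (Finset.mem_image_of_mem _ hG))), map_zero]

/-- Let `B` be a finitely presented `A`-algebra with nonempty fiber over a minimal prime of `A`.
There are an affine open `Spec A'` of `Spec A` and a finite étale cover `Spec C → Spec A'` such that
every point of `C` in a field lifts to a point of `B` after a purely inseparable extension. -/
theorem exists_finite_etale_cover [Algebra.FinitePresentation A B] (p : PrimeSpectrum A)
    (hp : p.asIdeal ∈ minimalPrimes A)
    (hpB : p ∈ Set.range (PrimeSpectrum.comap (algebraMap A B))) :
    ∃ (A' : Type u) (_ : CommRing A') (φ : A →+* A') (C : Type u) (_ : CommRing C)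
      (_ : Algebra A' C), IsOpenImmersion (Spec.map (CommRingCat.ofHom φ)) ∧ Nontrivial A' ∧
      Module.Finite A' C ∧ Algebra.Etale A' C ∧
      Function.Surjective (PrimeSpectrum.comap (algebraMap A' C)) ∧
      ∀ (F : Type u) [Field F] (χ : C →+* F), ∃ (F' : Type u) (_ : Field F') (_ : Algebra F F')
        (ω : B →+* F'), IsPurelyInseparable F F' ∧ ω.comp (algebraMap A B) =
          (algebraMap F F').comp (χ.comp ((algebraMap A' C).comp φ)) := by
  classical
  obtain ⟨K, _, _, β, hK, hβ⟩ := exists_finite_field_of_mem_range p hpB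
  obtain ⟨N, π, hπ, s, hs⟩ := Algebra.FinitePresentation.out (R := A) (A := B)
  let κ := p.asIdeal.ResidueField
  obtain ⟨θ, n, hθ, H⟩ := exists_isSeparable_forall_aeval_eq_pow κ K
  choose H hH using fun j ↦ H (β (π (MvPolynomial.X j)))
  let q := ringExpChar κ
  -- The Bézout coefficient `v` inverts the derivative at `θ`; its lift `a` witnesses étaleness.
  obtain ⟨u, v, huv⟩ : IsCoprime (minpoly κ θ) (derivative (minpoly κ θ)) := hθ
  obtain ⟨b, hb, hlift⟩ := exists_away_forall_mem_range p.asIdeal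
    ((minpoly κ θ).coeffs ∪ v.coeffs ∪ Finset.univ.biUnion fun j ↦ (H j).coeffs)
  let A₁ := Localization.Away b
  have hb0 : algebraMap A κ b ≠ 0 := by rwa [Ne, Ideal.algebraMap_residueField_eq_zero]
  let ψ : A₁ →+* κ := IsLocalization.Away.lift b hb0.isUnit
  have hψA : ψ.comp (algebraMap A A₁) = algebraMap A κ := IsLocalization.Away.lift_comp ..
  have hψ : NilpotentNearKer ψ := by
    refine NilpotentNearKer.localizationAway (ψ := algebraMap A κ) (b := b) ?_ hψA
    exact .of_mem_minimalPrimes (by rwa [Ideal.ker_algebraMap_residueField])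
  have hlift' (E : κ[X]) (hE : E.coeffs ⊆ (minpoly κ θ).coeffs ∪ v.coeffs ∪
      Finset.univ.biUnion fun j ↦ (H j).coeffs) : E ∈ lifts ψ := by
    rw [lifts_iff_coeff_lifts]
    intro i
    by_cases h0 : E.coeff i = 0
    · exact ⟨0, by rw [h0, map_zero]⟩
    · exact hlift A₁ ψ hψA _ (hE (coeff_mem_coeffs h0))
  have hθi : IsIntegral κ θ := Algebra.IsIntegral.isIntegral θ
  obtain ⟨g, hgθ, hgd, hg⟩ := lifts_and_natDegree_eq_and_monic
    (hlift' (minpoly κ θ) (Finset.subset_union_left.trans Finset.subset_union_left))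
    (minpoly.monic hθi)
  obtain ⟨a, rfl⟩ := (mem_lifts _).mp (hlift' v
    (Finset.subset_union_right.trans Finset.subset_union_left))
  choose h hh using fun j ↦ (mem_lifts _).mp (hlift' (H j)
    (.trans (Finset.subset_biUnion_of_mem (fun j ↦ (H j).coeffs) (Finset.mem_univ j))
      Finset.subset_union_right))
  have : ExpChar K q := expChar_of_injective_algebraMap (algebraMap κ K).injective _
  have hq0 : q ^ n ≠ 0 := pow_ne_zero _ (expChar_pos K q).ne'
  have hq : q = 1 ∨ q.Prime ∧ (q : κ) = 0 := eq_one_or_prime_and_cast_eq_zero κ q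
  let : Algebra A₁ K := ((algebraMap κ K).comp ψ).toAlgebra
  let : Algebra A K := ((algebraMap A₁ K).comp (algebraMap A A₁)).toAlgebra
  have : IsScalarTower A A₁ K := .of_algebraMap_eq' rfl
  have hβ' : β.comp (algebraMap A B) = algebraMap A K := by
    rw [hβ, RingHom.algebraMap_toAlgebra, RingHom.algebraMap_toAlgebra, RingHom.comp_assoc, hψA]
  let βA : B →ₐ[A] K := { β with commutes' := fun r ↦ DFunLike.congr_fun hβ' r }
  let Φ : A₁[X] →ₐ[A] K := (aeval θ).restrictScalars A
  have hΦ (E : A₁[X]) : Φ E = aeval θ (E.map ψ) := by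
    rw [aeval_def, eval₂_map]; rfl
  obtain ⟨b', hb', P, hPg, hPf, HP⟩ :=
    NilpotentNearKer.exists_standardEtalePair_of_frobEval hψ (θ := θ) (g := g) (a := a)
    (p := q) (n := n) hg hgθ (by rw [hgd]; exact (minpoly.natDegree_pos hθi).ne') (by
      have := congrArg (aeval θ) huv
      simp only [map_add, map_mul, minpoly.aeval, mul_zero, zero_add, map_one] at this
      simpa [← derivative_map, hgθ, sub_eq_zero] using this) hq s h (by
      intro G hG
      rw [← hΦ, map_frobEval]
      simp only [hΦ, hh, hH]
      rw [frobEval_pow hq0 (fun x y ↦ add_pow_expChar_pow x y q n), pow_eq_zero_iff hq0]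
      have h1 : MvPolynomial.aeval (fun j ↦ β (π (MvPolynomial.X j))) = βA.comp π :=
        MvPolynomial.algHom_ext fun j ↦ by simp [βA]
      have h2 : π G = 0 := by
        change G ∈ RingHom.ker π
        exact hs ▸ Ideal.subset_span hG
      rw [h1, AlgHom.comp_apply, h2, map_zero])
  let A₂ := Localization.Away b'
  refine ⟨A₂, inferInstance, (algebraMap A₁ A₂).comp (algebraMap A A₁), P.Ring, inferInstance,
    inferInstance, ?_, ?_, finite_of_g_eq_one P hPg, inferInstance,
    comap_surjective_of_g_eq_one P hPg hPf, fun F _ χ ↦ ?_⟩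
  · rw [CommRingCat.ofHom_comp, Spec.map_comp]
    have := IsOpenImmersion.of_isLocalization (R := A) (S := A₁) b
    have := IsOpenImmersion.of_isLocalization (R := A₁) (S := A₂) b'
    infer_instance
  · exact RingHom.domain_nontrivial (IsLocalization.Away.lift b' hb'.isUnit : A₂ →+* κ)
  · obtain ⟨F', _, _, y, hF', hy⟩ := HP F χ
    let ev := MvPolynomial.eval₂Hom ((algebraMap F F').comp (χ.comp
      ((algebraMap A₂ P.Ring).comp ((algebraMap A₁ A₂).comp (algebraMap A A₁))))) y
    -- The roots `y` satisfy the relations presenting `B`, so evaluation descends to `B`.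
    have hker : RingHom.ker π.toRingHom ≤ RingHom.ker ev := by
      rw [← hs, Ideal.span_le]
      exact fun G hG ↦ hy G hG
    let ω : B →+* F' := RingHom.liftOfSurjective π.toRingHom hπ ⟨ev, hker⟩
    have hω : ω.comp π.toRingHom = ev := RingHom.liftOfSurjective_comp ..
    refine ⟨F', inferInstance, inferInstance, ω, hF', RingHom.ext fun r ↦ ?_⟩
    have := DFunLike.congr_fun hω (MvPolynomial.C r)
    simpa [ev] using this

end ExistsCover

/-! ### Quasi-liftable points of morphisms of schemes -/

section Schemes

open Limits

variable {X Y Z S : Scheme.{u}}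

lemma mem_qRelTilde_comp {f : X ⟶ Y} {g : Y ⟶ Z} {x : X} (hf : x ∈ QRelTilde f)
    (hg : f x ∈ QRelTilde g) : x ∈ QRelTilde (f ≫ g) := by
  change ((f ≫ g).residueFieldMap x).hom.IsPurelyInseparable
  rw [Scheme.residueFieldMap_comp]
  exact RingHom.IsPurelyInseparable.comp hg hf

lemma mem_qRelTilde_of_comp {f : X ⟶ Y} {g : Y ⟶ Z} {x : X} (h : x ∈ QRelTilde (f ≫ g)) :
    f x ∈ QRelTilde g := by
  change ((f ≫ g).residueFieldMap x).hom.IsPurelyInseparable at h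
  rw [Scheme.residueFieldMap_comp] at h
  change RingHom.IsPurelyInseparable
    ((f.residueFieldMap x).hom.comp (g.residueFieldMap (f x)).hom) at h
  change RingHom.IsPurelyInseparable (g.residueFieldMap (f x)).hom
  algebraize [(g.residueFieldMap (f x)).hom, (f.residueFieldMap x).hom,
    (f.residueFieldMap x).hom.comp (g.residueFieldMap (f x)).hom]
  exact IsPurelyInseparable.tower_bot _ _ (X.residueField x)

lemma mem_qRelTilde_of_universallyInjective (f : X ⟶ Y) [UniversallyInjective f] (x : X) :
    x ∈ QRelTilde f :=
  have h : UniversallyInjective f ↔ Function.Injective f ∧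
    ∀ x, (f.residueFieldMap x).hom.IsPurelyInseparable := (tfae_universallyInjective f).out 0 2
  (h.mp ‹_›).2 x

/-- A homomorphism into a field extends in at most one way along a purely inseparable extension. -/
lemma universallyInjective_SpecMap_of_isPurelyInseparable (F F' : Type u) [Field F] [Field F']
    [Algebra F F'] [IsPurelyInseparable F F'] :
    UniversallyInjective (Spec.map (CommRingCat.ofHom (algebraMap F F'))) := by
  have tfae : UniversallyInjective (Spec.map (CommRingCat.ofHom (algebraMap F F'))) ↔
      ∀ (K : Type u) [Field K], Function.Injective fun g : Spec (.of K) ⟶ Spec (.of F') ↦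
        g ≫ Spec.map (CommRingCat.ofHom (algebraMap F F')) :=
    (tfae_universallyInjective _).out 0 1
  refine tfae.mpr fun K _ g₁ g₂ h ↦ ?_
  obtain ⟨φ₁, rfl⟩ := Spec.map_surjective g₁
  obtain ⟨φ₂, rfl⟩ := Spec.map_surjective g₂
  simp only [← Spec.map_comp] at h
  have h := congrArg CommRingCat.Hom.hom (Spec.map_injective h)
  exact congrArg Spec.map (CommRingCat.hom_ext
    (IsPurelyInseparable.injective_comp_algebraMap F F' K h))

lemma mem_relTilde_iff_of_etale (f : X ⟶ Y) [Etale f] (x : X) :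
    x ∈ RelTilde f ↔ x ∈ QRelTilde f := by
  change Function.Bijective (f.residueFieldMap x).hom ↔
    RingHom.IsPurelyInseparable (f.residueFieldMap x).hom
  let : Algebra (Y.residueField (f x)) (X.residueField x) := (f.residueFieldMap x).hom.toAlgebra
  have : Algebra.IsSeparable (Y.residueField (f x)) (X.residueField x) :=
    inferInstanceAs (Algebra.IsSeparable (Y.residueField (f.base x)) (X.residueField x))
  refine ⟨fun h ↦ ?_, fun h ↦ ?_⟩
  · change IsPurelyInseparable (Y.residueField (f x)) (X.residueField x)
    exact (AlgEquiv.ofBijective (Algebra.ofId (Y.residueField (f x)) (X.residueField x))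
      h).isPurelyInseparable
  · have : IsPurelyInseparable (Y.residueField (f x)) (X.residueField x) := h
    exact IsPurelyInseparable.bijective_algebraMap_of_isSeparable _ _

lemma exists_etale_isAffine (X : Scheme.{u}) [CompactSpace X] :
    ∃ (Y : Scheme.{u}) (q : Y ⟶ X), Surjective q ∧ Etale q ∧ IsAffine Y :=
  have : IsZariskiLocalAtSource @Etale := HasRingHomProperty.instIsZariskiLocalAtSource
  have : MorphismProperty.IsMultiplicative @Etale := inferInstance
  have := this.toContainsIdentities
  Scheme.exists_hom_isAffine_of_isZariskiLocalAtSource @Etale X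

/-- If finite étale covers of affine open subsets of `S` have quasi-liftable points, then so do
finite étale covers of affine schemes which are open in `S`. -/
lemma qRelTilde_nonempty_of_isOpenImmersion
    (h : ∀ (U : S.Opens), IsAffineOpen U → (U : Set S).Nonempty →
        ∀ (X : Scheme.{u}) (f : X ⟶ (U : Scheme.{u})),
          IsFinite f → Etale f → Surjective f → (QRel f).Nonempty)
    [IsAffine Y] [Nonempty Y] (j : Y ⟶ S) [IsOpenImmersion j] (f : X ⟶ Y) [IsFinite f] [Etale f]
    [Surjective f] : (QRelTilde f).Nonempty := by
  have hU : IsAffineOpen j.opensRange := isAffineOpen_opensRange j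
  obtain ⟨_, x, hx, -⟩ := h j.opensRange hU (by simpa using Set.range_nonempty j) X
    (f ≫ j.isoOpensRange.hom) inferInstance inferInstance inferInstance
  refine ⟨x, ?_⟩
  rw [← Category.comp_id f, ← j.isoOpensRange.hom_inv_id, ← Category.assoc]
  exact mem_qRelTilde_comp hx (mem_qRelTilde_of_universallyInjective _ _)

/-- `X₀` is compact as the image of `X`, so it has an affine étale cover `Y`, for which finite
presentation over the affine `U` is automatic. A quasi-liftable point of `Y` maps into `X₀` and
lifts along the radicial surjection. -/
lemma qRel_nonempty_of_isQuasiEtale (hS : IsPoonen S) (U : S.Opens) (hU : IsAffineOpen U)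
    (hU' : (U : Set S).Nonempty) (f : X ⟶ (U : Scheme.{u})) [QuasiCompact f] [Surjective f]
    (hf : IsQuasiEtale f) : (QRel f).Nonempty := by
  obtain ⟨X₀, ρ, π, _, _, _, _, rfl⟩ := hf
  have : IsAffine U := hU
  have : CompactSpace X := QuasiCompact.compactSpace_of_compactSpace (ρ ≫ π)
  have : CompactSpace X₀ := ρ.surjective.compactSpace ρ.continuous
  obtain ⟨Y, q, _, _, _⟩ := exists_etale_isAffine X₀
  have : Surjective π := .of_comp ρ π
  obtain ⟨_, y, hy, -⟩ := hS U hU' Y (q ≫ π) ⟨inferInstance, inferInstance, inferInstance⟩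
    inferInstance
  obtain ⟨x, hx⟩ := ρ.surjective (q y)
  refine ⟨_, x, mem_qRelTilde_comp (mem_qRelTilde_of_universallyInjective ρ x) ?_, rfl⟩
  rw [hx]
  exact mem_qRelTilde_of_comp hy

lemma isPoonen_of_finite_etale
    (h : ∀ (U : S.Opens), IsAffineOpen U → (U : Set S).Nonempty →
        ∀ (X : Scheme.{u}) (f : X ⟶ (U : Scheme.{u})),
          IsFinite f → Etale f → Surjective f → (QRel f).Nonempty) : IsPoonen S := by
  intro U hU X f ⟨_, _, _⟩ _
  obtain ⟨s, hs⟩ := hU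
  let 𝒰 := (U : Scheme.{u}).affineOpenCover
  obtain ⟨i, s', hs'⟩ := 𝒰.openCover.exists_eq ⟨s, hs⟩
  let A : CommRingCat.{u} := 𝒰.X i
  let w : Spec A ⟶ (U : Scheme.{u}) := 𝒰.f i
  have : IsOpenImmersion w := inferInstanceAs (IsOpenImmersion (𝒰.openCover.f i))
  have : Nonempty (Spec A) := ⟨s'⟩
  have : IsDominant (pullback.snd f w) :=
    IsZariskiLocalAtTarget.of_isPullback (P := @IsDominant) (.of_hasPullback f w) ‹_›
  have : CompactSpace ↥(pullback f w) :=
    QuasiCompact.compactSpace_of_compactSpace (pullback.snd f w)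
  obtain ⟨Y, q, _, _, _⟩ := exists_etale_isAffine (pullback f w)
  let e := Y.isoSpec
  obtain ⟨φ, hφ⟩ := Spec.map_surjective (e.inv ≫ q ≫ pullback.snd f w)
  have : IsDominant (Spec.map φ) := by rw [hφ]; infer_instance
  have hfp : LocallyOfFinitePresentation (Spec.map φ) := by rw [hφ]; infer_instance
  rw [HasRingHomProperty.Spec_iff (P := @LocallyOfFinitePresentation)] at hfp
  have : Nontrivial A := PrimeSpectrum.nonempty_iff_nontrivial.mp ‹_›
  obtain ⟨p, hp⟩ : Nonempty (minimalPrimes A) :=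
    Ideal.nonempty_minimalPrimes bot_ne_top
  algebraize [φ.hom]
  -- Density of the image means exactly that every minimal prime is hit.
  have hrange := (PrimeSpectrum.denseRange_comap_iff_minimalPrimes φ.hom).mp
    (show DenseRange (PrimeSpectrum.comap φ.hom) from (Spec.map φ).denseRange) p hp
  obtain ⟨A', _, ψ, C, _, _, _, _, _, _, hsurj, hC⟩ :=
    exists_finite_etale_cover (A := A) (B := Γ(Y, ⊤)) ⟨p, hp.1.1⟩ hp hrange
  let t : Spec (.of C) ⟶ Spec (.of A') := Spec.map (CommRingCat.ofHom (algebraMap A' C))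
  have : IsFinite t := by
    rw [IsFinite.SpecMap_iff]; exact RingHom.finite_algebraMap.mpr ‹_›
  have : Etale t := by
    rw [HasRingHomProperty.Spec_iff (P := @Etale)]; exact RingHom.etale_algebraMap.mpr ‹_›
  have : Surjective t := ⟨hsurj⟩
  let v : Spec (.of A') ⟶ Spec A := Spec.map (CommRingCat.ofHom ψ)
  have : IsOpenImmersion v := ‹_›
  have : Nonempty (Spec (.of A')) := PrimeSpectrum.nonempty_iff_nontrivial.mpr ‹_›
  obtain ⟨c, hc⟩ := qRelTilde_nonempty_of_isOpenImmersion h (v ≫ w ≫ U.ι) t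
  let F := (Spec (.of C)).residueField c
  obtain ⟨χ, hχ⟩ := Spec.map_surjective ((Spec (.of C)).fromSpecResidueField c)
  obtain ⟨F', _, _, ω, _, hω⟩ := hC F χ.hom
  let r : Spec (.of F') ⟶ Spec (.of C) :=
    Spec.map (CommRingCat.ofHom (algebraMap F F')) ≫ (Spec (.of C)).fromSpecResidueField c
  have := universallyInjective_SpecMap_of_isPurelyInseparable F F'
  let z : Spec (.of F') := IsLocalRing.closedPoint F'
  have hr : z ∈ QRelTilde r := mem_qRelTilde_comp (mem_qRelTilde_of_universallyInjective _ _)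
    (mem_qRelTilde_of_universallyInjective _ _)
  have hz : r z = c := (Scheme.Hom.comp_apply ..).trans (Scheme.fromSpecResidueField_apply ..)
  have hz' : z ∈ QRelTilde (r ≫ t ≫ v ≫ w) :=
    mem_qRelTilde_comp hr
      (mem_qRelTilde_comp (hz ▸ hc) (mem_qRelTilde_of_universallyInjective _ _))
  -- The purely inseparable point `Spec F' → U` through the étale cover also factors through `f`, so
  -- its image in `X` is quasi-liftable.
  have hcomm : r ≫ t ≫ v ≫ w =
      (Spec.map (CommRingCat.ofHom ω) ≫ e.inv ≫ q ≫ pullback.fst f w) ≫ f := by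
    have h₁ : Spec.map (CommRingCat.ofHom ω) ≫ Spec.map φ = r ≫ t ≫ v := by
      have := congrArg (fun x ↦ Spec.map (CommRingCat.ofHom x)) hω
      simp only [CommRingCat.ofHom_comp, Spec.map_comp, CommRingCat.ofHom_hom, hχ,
        Category.assoc] at this
      exact this
    have h₂ : r ≫ t ≫ v ≫ w = (r ≫ t ≫ v) ≫ w := by simp only [Category.assoc]
    rw [h₂, ← h₁, hφ]
    simp only [Category.assoc, pullback.condition]
  rw [hcomm] at hz'
  exact ⟨_, _, mem_qRelTilde_of_comp hz', rfl⟩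

end Schemes

end PoonenScheme

open PoonenScheme in
theorem proposition4p1p1 (S : Scheme.{u}) :
    List.TFAE [
      IsPoonen S,
      ∀ (U : S.Opens), IsAffineOpen U → (U : Set S).Nonempty →
        ∀ (X : Scheme.{u}) (f : X ⟶ (U : Scheme.{u})),
          IsFinite f → Surjective f → IsQuasiEtale f → (QRel f).Nonempty,
      ∀ (U : S.Opens), IsAffineOpen U → (U : Set S).Nonempty →
        ∀ (X : Scheme.{u}) (f : X ⟶ (U : Scheme.{u})),
          IsFinite f → Etale f → Surjective f → (QRel f).Nonempty,
      ∀ (U : S.Opens), IsAffineOpen U → (U : Set S).Nonempty →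
        ∀ (X : Scheme.{u}) (f : X ⟶ (U : Scheme.{u})),
          IsFinite f → Etale f → Surjective f → (Rel f).Nonempty] := by
  tfae_have 1 → 2 := fun hS U hU hU' X f _ _ hf ↦ qRel_nonempty_of_isQuasiEtale hS U hU hU' f hf
  tfae_have 2 → 3 := fun h U hU hU' X f hfin hf hsurj ↦
    h U hU hU' X f hfin hsurj ⟨X, 𝟙 X, f, inferInstance, inferInstance, inferInstance, hf,
      Category.id_comp f⟩
  tfae_have 3 → 1 := isPoonen_of_finite_etale
  tfae_have 3 → 4 := fun h U hU hU' X f hfin hf hsurj ↦ by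
    obtain ⟨_, x, hx, rfl⟩ := h U hU hU' X f hfin hf hsurj
    exact ⟨_, x, (mem_relTilde_iff_of_etale f x).mpr hx, rfl⟩
  tfae_have 4 → 3 := fun h U hU hU' X f hfin hf hsurj ↦ by
    obtain ⟨_, x, hx, rfl⟩ := h U hU hU' X f hfin hf hsurj
    exact ⟨_, x, (mem_relTilde_iff_of_etale f x).mp hx, rfl⟩
  tfae_finish
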